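/- **Theorem (Multilinear Hardy–Littlewood–Sobolev inequality).** Let $n,m\ge 1$ be integers, let $1<p<q<\infty$, and let $p'$ denote the dual exponent, $1/p+1/p'=1$. Let $1<s_k<p'$ for $k=1,\dots,m$, and suppose that $$\frac1q+\frac m{p'}=\sum_{k=1}^m\frac1{s_k}.$$ Then there is a constant $C<\infty$, depending only on $n,m,p,q,s_1,\dots,s_m$, such that for every complex-valued $H\in L^p(\mathbb R^{mn})$, $H=H(y_1,\dots,y_m)$ with $y_k\in\mathbb R^n$, the integral $$F(x)=\int_{\mathbb R^{mn}}\prod_{k=1}^m|x-y_k|^{-\lambda_k}\,H(y_1,\dots,y_m)\,dy_1\cdots dy_m,\qquad \lambda_k=\frac n{s_k},$$ converges absolutely for almost every $x\in\mathbb R^n$, the function $F$ belongs to $L^q(\mathbb R^n)$, and $$\|F\|_{L^q(\mathbb R^n)}\le C\,\|H\|_{L^p(\mathbb R^{mn})}.$$ Here $|\cdot|$ is the Euclidean norm on $\mathbb R^n$ and all integrals and $L^p$ norms are with respect to Lebesgue measure. -/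

import Mathlib

open MeasureTheory

/-- The multilinear Riesz kernel `∏ₖ |x - yₖ|^{-λₖ}` on `ℝⁿ × (ℝⁿ)ᵐ`. (Lean gives the factor
`|x - yₖ|^{-λₖ}` the value `0` at `yₖ = x` when `λₖ ≠ 0`; for `n ≥ 1` this concerns, for each `x`,
only a null set of `y`.) -/
noncomputable def rieszKernel {n m : ℕ} (lam : Fin m → ℝ)
    (x : EuclideanSpace ℝ (Fin n)) (y : Fin m → EuclideanSpace ℝ (Fin n)) : ℝ :=
  ∏ k, ‖x - y k‖ ^ (-lam k)

/-- The function
`F(x) = ∫_{(ℝⁿ)ᵐ} ∏ₖ |x - yₖ|^{-λₖ} H(y₁, …, yₘ) dy`. -/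
noncomputable def multilinearRiesz {n m : ℕ} (lam : Fin m → ℝ)
    (H : (Fin m → EuclideanSpace ℝ (Fin n)) → ℂ) (x : EuclideanSpace ℝ (Fin n)) : ℂ :=
  ∫ y : Fin m → EuclideanSpace ℝ (Fin n), (rieszKernel lam x y : ℂ) * H y

/-! The proof is a Hedberg-type pointwise bound that needs no maximal function. Replace `H` by `h =
|H|`, normalised in `L^p`, fix a real parameter `X`, and put `Y = p log h(y)`, `Z_k = -n log |x -
y_k|`. By the scaling condition, `X(1 - 1/q) + Y/p + ∑ Z_k/s_k` is a convex combination of `X + Y`,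
`X + ∑ Z_k` and the `Y + Z_k`, with weights `1/p - 1/q`, `1/p'` and `1/s_k - 1/p'`. The hypotheses
make every weight positive, so the combination lies below the largest entry by a fixed multiple of
all differences between entries. This gain turns the critical `|w|^{-n}` into the integrable
`logKernel` (`exp_convex_combination_le`).

Integrating in `y` gives `e^{X(1-1/q)} F(x) ≤ e^X B + R(x)`, where `F` is the potential of `h` and
`R` is `hedbergMajorant`. Taking `e^X = R(x)` yields `F^q ≤ C R`. Since the integral of `logKernel`
does not depend on its parameter `b`, Tonelli gives `∫ R = C' ∫ h^p`. -/

/-! ### Strict convexity with a quantitative gain -/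

/-- A convex combination of reals, all of whose weights are at least `ε`, lies below the largest of
them by at least `ε` times any of their differences. -/
theorem exists_forall_sum_mul_le_sub {ι : Type*} [Fintype ι] [Nonempty ι] (θ L : ι → ℝ) {ε : ℝ}
    (hε : 0 ≤ ε) (hθ : ∀ i, ε ≤ θ i) (hsum : ∑ i, θ i = 1) :
    ∃ v, ∀ i j, ∑ u, θ u * L u ≤ L v - ε * |L i - L j| := by
  obtain ⟨v, hv⟩ := Finite.exists_max L
  have key : ∀ i j, ∑ u, θ u * L u ≤ L v - ε * (L i - L j) := by
    intro i j
    have h1 : θ j * (L v - L j) ≤ ∑ u, θ u * (L v - L u) :=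
      Finset.single_le_sum (f := fun u => θ u * (L v - L u))
        (fun u _ => mul_nonneg (hε.trans (hθ u)) (sub_nonneg.2 (hv u))) (Finset.mem_univ j)
    have h2 : ∑ u, θ u * (L v - L u) = L v - ∑ u, θ u * L u := by
      simp only [mul_sub, Finset.sum_sub_distrib, ← Finset.sum_mul, hsum, one_mul]
    have h3 : ε * (L i - L j) ≤ θ j * (L v - L j) := by
      calc ε * (L i - L j) ≤ ε * (L v - L j) := by gcongr; exact hv i
        _ ≤ _ := mul_le_mul_of_nonneg_right (hθ j) (sub_nonneg.2 (hv j))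
    linarith
  refine ⟨v, fun i j => ?_⟩
  rcases abs_cases (L i - L j) with ⟨h, _⟩ | ⟨h, _⟩
  · rw [h]; exact key i j
  · rw [h, neg_sub]; exact key j i

/-- Exponentials of strict convex combinations of `X + Y`, `X + ∑ Zₖ` and the `Y + Zₖ` are bounded
by the sum of their exponentials, with decaying factors. -/
theorem exp_convex_combination_le {m : ℕ} (hm : 0 < m) {ε θ₀ θ₁ : ℝ} (θ : Fin m → ℝ) (hε : 0 ≤ ε)
    (h₀ : ε ≤ θ₀) (h₁ : ε ≤ θ₁) (hθ : ∀ k, ε ≤ θ k) (hsum : θ₀ + θ₁ + ∑ k, θ k = 1)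
    (X Y : ℝ) (Z : Fin m → ℝ) :
    Real.exp (θ₀ * (X + Y) + θ₁ * (X + ∑ k, Z k) + ∑ k, θ k * (Y + Z k)) ≤
      Real.exp X * Real.exp Y
      + Real.exp X * ∏ k, Real.exp (Z k - ε / (m + 1) * |X - Z k|)
      + ∑ k, Real.exp Y * Real.exp (Z k - ε / (m + 1) * |Y / m - Z k|) := by
  have hm' : (0 : ℝ) < m := by exact_mod_cast hm
  let L : Option (Option (Fin m)) → ℝ :=
    fun v => v.elim (X + Y) fun w => w.elim (X + ∑ k, Z k) fun k => Y + Z k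
  let Θ : Option (Option (Fin m)) → ℝ := fun v => v.elim θ₀ fun w => w.elim θ₁ θ
  obtain ⟨v, hv⟩ := exists_forall_sum_mul_le_sub Θ L hε
    (by rintro (_ | _ | k); exacts [h₀, h₁, hθ k])
    (by simp only [Fintype.sum_option, Θ, Option.elim]; linarith)
  have hS : ∑ u, Θ u * L u =
      θ₀ * (X + Y) + θ₁ * (X + ∑ k, Z k) + ∑ k, θ k * (Y + Z k) := by
    simp only [Fintype.sum_option, Θ, L, Option.elim]; ring
  rw [hS] at hv
  generalize θ₀ * (X + Y) + θ₁ * (X + ∑ k, Z k) + ∑ k, θ k * (Y + Z k) = S at hv ⊢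
  have n0 : 0 ≤ Real.exp X * Real.exp Y := by positivity
  have n1 : 0 ≤ Real.exp X * ∏ k, Real.exp (Z k - ε / (m + 1) * |X - Z k|) := by positivity
  have n2 : 0 ≤ ∑ k, Real.exp Y * Real.exp (Z k - ε / (m + 1) * |Y / m - Z k|) := by positivity
  rcases v with _ | _ | k
  · have : S ≤ X + Y := by simpa [L] using hv none none
    have := Real.exp_le_exp.2 this
    rw [Real.exp_add] at this
    linarith
  · have hk : ∀ k, ε * |X - Z k| ≤ X + ∑ k, Z k - S := by
      intro k
      have := hv none (some (some k))
      simp only [L, Option.elim] at this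
      rw [show X + Y - (Y + Z k) = X - Z k by ring] at this
      linarith
    have h0 : 0 ≤ X + ∑ k, Z k - S := (mul_nonneg hε (abs_nonneg _)).trans (hk ⟨0, hm⟩)
    -- The single gain is shared among the `m` factors, so each of them decays on its own.
    have : S ≤ X + ∑ k, (Z k - ε / (m + 1) * |X - Z k|) := by
      have h3 : ∑ k, ε / (m + 1) * |X - Z k| ≤ ∑ _k : Fin m, (X + ∑ k, Z k - S) / (m + 1) := by
        gcongr with k
        rw [div_mul_eq_mul_div]
        gcongr
        exact hk k
      rw [Finset.sum_const, Finset.card_univ, Fintype.card_fin, nsmul_eq_mul] at h3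
      have h4 : (m : ℝ) * ((X + ∑ k, Z k - S) / (m + 1)) ≤ X + ∑ k, Z k - S := by
        rw [mul_div_assoc', div_le_iff₀ (by positivity)]
        nlinarith
      rw [Finset.sum_sub_distrib]
      linarith
    have := Real.exp_le_exp.2 this
    rw [Real.exp_add, Real.exp_sum] at this
    linarith
  · have hd : ∀ i j, ε * |L i - L j| ≤ Y + Z k - S := fun i j => by
      have := hv i j
      simp only [L, Option.elim] at this ⊢
      linarith
    have h0 : ε * |Y - ∑ l, Z l| ≤ Y + Z k - S := by
      have := hd none (some none)
      simp only [L, Option.elim] at this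
      rwa [show X + Y - (X + ∑ l, Z l) = Y - ∑ l, Z l by ring] at this
    have hl : ∀ l, ε * |Z l - Z k| ≤ Y + Z k - S := fun l => by
      have := hd (some (some l)) (some (some k))
      simp only [L, Option.elim] at this
      rwa [show Y + Z l - (Y + Z k) = Z l - Z k by ring] at this
    -- Replacing every `Z l` by `Z k` leaves a penalty free of the other variables, so that it can
    -- later be integrated in `x` with `y` fixed.
    have hmk : ε * |Y - m * Z k| ≤ (m + 1) * (Y + Z k - S) := by
      have e : Y - m * Z k = (Y - ∑ l, Z l) + ∑ l, (Z l - Z k) := by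
        simp [Finset.sum_sub_distrib]
      calc ε * |Y - m * Z k| ≤ ε * (|Y - ∑ l, Z l| + ∑ l, |Z l - Z k|) := by
            rw [e]
            gcongr
            exact (abs_add_le _ _).trans (by gcongr; exact Finset.abs_sum_le_sum_abs _ _)
        _ = ε * |Y - ∑ l, Z l| + ∑ l, ε * |Z l - Z k| := by rw [mul_add, Finset.mul_sum]
        _ ≤ (Y + Z k - S) + ∑ _l : Fin m, (Y + Z k - S) := by
            gcongr with l
            exact hl l
        _ = _ := by simp; ring
    have h0' : 0 ≤ Y + Z k - S := (mul_nonneg hε (abs_nonneg _)).trans h0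
    have : S ≤ Y + (Z k - ε / (m + 1) * |Y / m - Z k|) := by
      have e : |Y / m - Z k| = |Y - m * Z k| / m := by
        rw [← abs_of_pos hm', ← abs_div, abs_of_pos hm']
        congr 1
        field_simp
      have : ε / (m + 1) * |Y / m - Z k| ≤ Y + Z k - S := by
        rw [e, div_mul_div_comm, div_le_iff₀ (by positivity)]
        have : (1 : ℝ) ≤ m := by exact_mod_cast hm
        nlinarith [mul_nonneg h0' (sub_nonneg.2 this)]
      linarith
    have := Real.exp_le_exp.2 this
    rw [Real.exp_add] at this
    have h5 := Finset.single_le_sum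
      (f := fun k => Real.exp Y * Real.exp (Z k - ε / (m + 1) * |Y / m - Z k|))
      (fun _ _ => by positivity) (Finset.mem_univ k)
    linarith

/-! ### The integrable logarithmic kernel -/

/-- The function `|w|⁻ⁿ exp (-δ |b + n log |w||)` on `ℝⁿ`. -/
noncomputable def logKernel {n : ℕ} (δ b : ℝ) (w : EuclideanSpace ℝ (Fin n)) : ℝ :=
  Real.exp (-(n * Real.log ‖w‖) - δ * |b + n * Real.log ‖w‖|)

theorem logKernel_pos {n : ℕ} (δ b : ℝ) (w : EuclideanSpace ℝ (Fin n)) : 0 < logKernel δ b w :=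
  Real.exp_pos _

/-- In polar coordinates the radial density is `t^(-1 + δn)` on `(0, 1]` and `t^(-1 - δn)` beyond.
-/
theorem integrable_logKernel_zero {n : ℕ} (hn : 1 ≤ n) {δ : ℝ} (hδ : 0 < δ) :
    Integrable (logKernel δ 0 : EuclideanSpace ℝ (Fin n) → ℝ) := by
  have hn' : (0 : ℝ) < n := by exact_mod_cast hn
  have : Nonempty (Fin n) := ⟨⟨0, hn⟩⟩
  change Integrable fun w : EuclideanSpace ℝ (Fin n) =>
    (fun t : ℝ => Real.exp (-(n * Real.log t) - δ * |0 + n * Real.log t|)) ‖w‖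
  rw [integrable_fun_norm_addHaar volume (f := fun t : ℝ =>
    Real.exp (-(n * Real.log t) - δ * |0 + n * Real.log t|)), finrank_euclideanSpace, Fintype.card_fin]
  have hpow : ∀ t : ℝ, 0 < t → t ^ (n - 1) = Real.exp ((n - 1) * Real.log t) := fun t ht => by
    rw [← Real.rpow_natCast, Real.rpow_def_of_pos ht, Nat.cast_sub hn, Nat.cast_one, mul_comm]
  rw [← Set.Ioc_union_Ioi_eq_Ioi zero_le_one]
  refine IntegrableOn.union ?_ ?_
  · have : IntegrableOn (fun t : ℝ => t ^ (-1 + δ * n)) (Set.Ioc 0 1) := by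
      rw [← intervalIntegrable_iff_integrableOn_Ioc_of_le zero_le_one]
      exact intervalIntegral.intervalIntegrable_rpow' (by nlinarith [mul_pos hδ hn'])
    refine this.congr_fun (fun t ht => ?_) measurableSet_Ioc
    have hlog : Real.log t ≤ 0 := Real.log_nonpos ht.1.le ht.2
    simp only [smul_eq_mul]
    rw [hpow t ht.1, Real.rpow_def_of_pos ht.1, ← Real.exp_add, zero_add,
      abs_of_nonpos (mul_nonpos_of_nonneg_of_nonpos hn'.le hlog)]
    congr 1
    ring
  · have : IntegrableOn (fun t : ℝ => t ^ (-1 - δ * n)) (Set.Ioi 1) :=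
      integrableOn_Ioi_rpow_of_lt (by nlinarith [mul_pos hδ hn']) one_pos
    refine this.congr_fun (fun t ht => ?_) measurableSet_Ioi
    have ht0 : (0 : ℝ) < t := one_pos.trans ht
    have hlog : 0 ≤ Real.log t := Real.log_nonneg (le_of_lt ht)
    simp only [smul_eq_mul]
    rw [hpow t ht0, Real.rpow_def_of_pos ht0, ← Real.exp_add, zero_add,
      abs_of_nonneg (mul_nonneg hn'.le hlog)]
    congr 1
    ring

/-- Dilation shifts `n log ‖w‖` by `-b`. The origin is excluded because there `Real.log 0 = 0`
breaks the shift. -/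
theorem logKernel_smul_ae {n : ℕ} (hn : 1 ≤ n) (δ b : ℝ) :
    (fun w : EuclideanSpace ℝ (Fin n) => logKernel δ b (Real.exp (-b / n) • w)) =ᵐ[volume]
      fun w => Real.exp b * logKernel δ 0 w := by
  have hn' : (0 : ℝ) < n := by exact_mod_cast hn
  have : Nonempty (Fin n) := ⟨⟨0, hn⟩⟩
  filter_upwards [Measure.ae_ne volume (0 : EuclideanSpace ℝ (Fin n))] with w hw
  have hlog : n * Real.log ‖Real.exp (-b / n) • w‖ = -b + n * Real.log ‖w‖ := by
    rw [norm_smul, Real.norm_eq_abs, Real.abs_exp,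
      Real.log_mul (Real.exp_ne_zero _) (norm_ne_zero_iff.2 hw), Real.log_exp]
    field_simp
  rw [logKernel, logKernel, hlog, ← Real.exp_add]
  congr 1
  rw [show b + (-b + n * Real.log ‖w‖) = 0 + n * Real.log ‖w‖ by ring]
  ring

theorem integrable_logKernel {n : ℕ} (hn : 1 ≤ n) {δ : ℝ} (hδ : 0 < δ) (b : ℝ) :
    Integrable (logKernel δ b : EuclideanSpace ℝ (Fin n) → ℝ) := by
  rw [← integrable_comp_smul_iff volume _ (Real.exp_ne_zero (-b / n)),
    integrable_congr (logKernel_smul_ae hn δ b)]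
  exact (integrable_logKernel_zero hn hδ).const_mul _

/-- The Jacobian of the dilation cancels the factor `exp b`. -/
theorem integral_logKernel {n : ℕ} (hn : 1 ≤ n) (δ b : ℝ) :
    ∫ w : EuclideanSpace ℝ (Fin n), logKernel δ b w =
      ∫ w : EuclideanSpace ℝ (Fin n), logKernel δ 0 w := by
  have hn' : (0 : ℝ) < n := by exact_mod_cast hn
  have h := Measure.integral_comp_smul volume
    (logKernel δ b : EuclideanSpace ℝ (Fin n) → ℝ) (Real.exp (-b / n))
  rw [integral_congr_ae (logKernel_smul_ae hn δ b), integral_const_mul, finrank_euclideanSpace,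
    Fintype.card_fin, ← Real.exp_nat_mul, mul_div_cancel₀ _ hn'.ne', Real.exp_neg, inv_inv,
    Real.abs_exp, smul_eq_mul] at h
  exact (mul_left_cancel₀ (Real.exp_ne_zero b) h).symm

theorem lintegral_logKernel {n : ℕ} (hn : 1 ≤ n) {δ : ℝ} (hδ : 0 < δ) (b : ℝ) :
    ∫⁻ w : EuclideanSpace ℝ (Fin n), ENNReal.ofReal (logKernel δ b w) =
      ENNReal.ofReal (∫ w : EuclideanSpace ℝ (Fin n), logKernel δ 0 w) := by
  rw [← ofReal_integral_eq_lintegral_ofReal (integrable_logKernel hn hδ b)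
    (.of_forall fun w => (logKernel_pos δ b w).le), integral_logKernel hn]

theorem lintegral_prod_logKernel {n m : ℕ} (hn : 1 ≤ n) {δ : ℝ} (hδ : 0 < δ) (b : ℝ)
    (x : EuclideanSpace ℝ (Fin n)) :
    ∫⁻ y : Fin m → EuclideanSpace ℝ (Fin n), ENNReal.ofReal (∏ k, logKernel δ b (x - y k)) =
      ENNReal.ofReal ((∫ w : EuclideanSpace ℝ (Fin n), logKernel δ 0 w) ^ m) := by
  have hint : Integrable fun y : Fin m → EuclideanSpace ℝ (Fin n) =>
      ∏ k, logKernel δ b (x - y k) :=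
    Integrable.fintype_prod (f := fun (_ : Fin m) (z : EuclideanSpace ℝ (Fin n)) =>
      logKernel δ b (x - z)) fun _ => (integrable_logKernel hn hδ b).comp_sub_left x
  rw [← ofReal_integral_eq_lintegral_ofReal hint
    (.of_forall fun y => Finset.prod_nonneg fun k _ => (logKernel_pos δ b _).le),
    integral_fintype_prod_volume_eq_pow (fun z : EuclideanSpace ℝ (Fin n) => logKernel δ b (x - z)),
    integral_sub_left_eq_self (logKernel δ b) volume x, integral_logKernel hn, Fintype.card_fin]

theorem measurable_logKernel {n : ℕ} (δ : ℝ) :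
    Measurable fun z : ℝ × EuclideanSpace ℝ (Fin n) => logKernel δ z.1 z.2 := by
  unfold logKernel
  fun_prop

theorem measurable_rieszKernel {n m : ℕ} (lam : Fin m → ℝ) :
    Measurable fun z : EuclideanSpace ℝ (Fin n) × (Fin m → EuclideanSpace ℝ (Fin n)) =>
      rieszKernel lam z.1 z.2 := by
  unfold rieszKernel
  fun_prop

theorem rieszKernel_nonneg {n m : ℕ} (lam : Fin m → ℝ) (x : EuclideanSpace ℝ (Fin n))
    (y : Fin m → EuclideanSpace ℝ (Fin n)) : 0 ≤ rieszKernel lam x y :=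
  Finset.prod_nonneg fun _ _ => Real.rpow_nonneg (norm_nonneg _) _

/-! ### Pointwise Hedberg bound -/

/-- Optimisation of a family of bounds over the parameter `X`. -/
theorem ENNReal.le_of_forall_exp_mul_le {F R B : ENNReal} {q : ℝ} (hq : 0 < q) (hB : B ≠ ⊤)
    (h : ∀ X : ℝ, ENNReal.ofReal (Real.exp (X * (1 - 1 / q))) * F ≤
      ENNReal.ofReal (Real.exp X) * B + R) : F ≤ (B + 1) * R ^ (1 / q) := by
  have h' : ∀ X : ℝ, F ≤ ENNReal.ofReal (Real.exp (X / q)) * B +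
      ENNReal.ofReal (Real.exp (X / q - X)) * R := by
    intro X
    have e : ∀ a b : ℝ, ENNReal.ofReal (Real.exp a) * ENNReal.ofReal (Real.exp b) =
        ENNReal.ofReal (Real.exp (a + b)) := fun a b => by
      rw [← ENNReal.ofReal_mul (Real.exp_pos _).le, Real.exp_add]
    have := mul_le_mul_right (h X) (ENNReal.ofReal (Real.exp (X / q - X)))
    rw [← mul_assoc, e, mul_add, ← mul_assoc, e] at this
    rwa [show X / q - X + X * (1 - 1 / q) = 0 by ring, sub_add_cancel, Real.exp_zero,
      ENNReal.ofReal_one, one_mul] at this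
  rcases eq_or_ne R ⊤ with rfl | hR
  · rw [ENNReal.top_rpow_of_pos (by positivity), ENNReal.mul_top (by simp)]
    exact le_top
  -- When `R = 0` the infimum is reached only as `X → -∞`; otherwise `X = log R` makes both
  -- exponentials equal to `R ^ (1 / q)`.
  rcases eq_or_ne R 0 with rfl | hR0
  · have hlim : Filter.Tendsto (fun X : ℝ => ENNReal.ofReal (Real.exp (X / q)) * B)
        Filter.atBot (nhds (ENNReal.ofReal 0 * B)) := by
      refine ENNReal.Tendsto.mul_const (ENNReal.tendsto_ofReal ?_) (Or.inr hB)
      exact Real.tendsto_exp_atBot.comp (Filter.tendsto_id.atBot_div_const hq)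
    have : F ≤ ENNReal.ofReal 0 * B := ge_of_tendsto' hlim fun X => by simpa using h' X
    simp only [ENNReal.ofReal_zero, zero_mul] at this
    exact this.trans zero_le
  · have hRpos : 0 < R.toReal := ENNReal.toReal_pos hR0 hR
    have hRe : R = ENNReal.ofReal (Real.exp (Real.log R.toReal)) := by
      rw [Real.exp_log hRpos, ENNReal.ofReal_toReal hR]
    have hX := h' (Real.log R.toReal)
    set X := Real.log R.toReal
    have hRq : R ^ (1 / q) = ENNReal.ofReal (Real.exp (X / q)) := by
      rw [hRe, ENNReal.ofReal_rpow_of_pos (Real.exp_pos _), ← Real.exp_mul, mul_one_div]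
    rw [hRq]
    refine hX.trans_eq ?_
    rw [hRe, ← ENNReal.ofReal_mul (Real.exp_pos _).le, ← Real.exp_add, sub_add_cancel]
    ring

theorem exp_mul_rieszKernel_mul_le {n m : ℕ} (hn : 1 ≤ n) (hm : 0 < m) {p q ε : ℝ} {s : Fin m → ℝ}
    (hp : 1 < p) (hs : ∀ k, 0 < s k) (hε : 0 ≤ ε) (h₀ : ε ≤ 1 / p - 1 / q) (h₁ : ε ≤ 1 - 1 / p)
    (hθ : ∀ k, ε ≤ 1 / s k - (1 - 1 / p)) (hscale : 1 / q + m * (1 - 1 / p) = ∑ k, 1 / s k)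
    (x : EuclideanSpace ℝ (Fin n)) (y : Fin m → EuclideanSpace ℝ (Fin n)) {a : ℝ} (ha : 0 ≤ a)
    (X : ℝ) :
    Real.exp (X * (1 - 1 / q)) * (rieszKernel (fun k => n / s k) x y * a) ≤
      Real.exp X * a ^ p + Real.exp X * ∏ k, logKernel (ε / (m + 1)) X (x - y k)
      + ∑ k, a ^ p * logKernel (ε / (m + 1)) (p * Real.log a / m) (x - y k) := by
  have hn' : (0 : ℝ) < n := by exact_mod_cast hn
  have hp0 : 0 < p := by linarith
  have hpos : 0 ≤ Real.exp X * a ^ p + Real.exp X * ∏ k, logKernel (ε / (m + 1)) X (x - y k)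
      + ∑ k, a ^ p * logKernel (ε / (m + 1)) (p * Real.log a / m) (x - y k) := by
    have := Real.rpow_nonneg ha p
    have h1 := Finset.prod_nonneg fun (k : Fin m) (_ : k ∈ Finset.univ) =>
      (logKernel_pos (ε / (m + 1)) X (x - y k)).le
    have h2 := Finset.sum_nonneg fun (k : Fin m) (_ : k ∈ Finset.univ) =>
      mul_nonneg this (logKernel_pos (ε / (m + 1)) (p * Real.log a / m) (x - y k)).le
    have := Real.exp_pos X
    positivity
  rcases ha.eq_or_lt with rfl | ha
  · simpa using hpos
  -- On the diagonal the kernel takes the default value `0`, whereas the logarithms used below need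
  -- `x ≠ y k`.
  by_cases hxy : ∃ k, x = y k
  · obtain ⟨k, hk⟩ := hxy
    have : rieszKernel (fun k => n / s k) x y = 0 := by
      refine Finset.prod_eq_zero (Finset.mem_univ k) ?_
      rw [hk, sub_self, norm_zero, Real.zero_rpow]
      exact neg_ne_zero.2 (div_pos hn' (hs k)).ne'
    rw [this, zero_mul, mul_zero]
    exact hpos
  push Not at hxy
  set Y := p * Real.log a with hY
  set Z : Fin m → ℝ := fun k => -(n * Real.log ‖x - y k‖) with hZ
  have key := exp_convex_combination_le hm (fun k => 1 / s k - (1 - 1 / p)) hε h₀ h₁ hθ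
    (by simp only [Finset.sum_sub_distrib, ← hscale]; simp; ring) X Y Z
  have e1 : rieszKernel (fun k => n / s k) x y = Real.exp (∑ k, 1 / s k * Z k) := by
    rw [rieszKernel, Real.exp_sum]
    refine Finset.prod_congr rfl fun k _ => ?_
    rw [Real.rpow_def_of_pos (norm_pos_iff.2 (sub_ne_zero.2 (hxy k)))]
    congr 1
    simp only [hZ]
    ring
  have e2 : a = Real.exp (1 / p * Y) := by
    rw [hY, one_div, inv_mul_cancel_left₀ hp0.ne', Real.exp_log ha]
  have e3 : a ^ p = Real.exp Y := by
    rw [Real.rpow_def_of_pos ha, mul_comm]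
  have e4 : ∀ b k, logKernel (ε / (m + 1)) b (x - y k) =
      Real.exp (Z k - ε / (m + 1) * |b - Z k|) := fun b k => by
    simp only [hZ, logKernel, sub_neg_eq_add]
  have e5 : Real.exp (X * (1 - 1 / q)) * (rieszKernel (fun k => n / s k) x y * a) =
      Real.exp ((1 / p - 1 / q) * (X + Y) + (1 - 1 / p) * (X + ∑ k, Z k) +
        ∑ k, (1 / s k - (1 - 1 / p)) * (Y + Z k)) := by
    have : ∑ k, (1 / s k - (1 - 1 / p)) * (Y + Z k) =
        (1 / q) * Y + ∑ k, 1 / s k * Z k - (1 - 1 / p) * ∑ k, Z k := by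
      simp only [sub_mul, mul_add, Finset.sum_sub_distrib, Finset.sum_add_distrib,
        ← Finset.sum_mul, ← Finset.mul_sum, ← hscale]
      simp
      ring
    rw [this, e1]
    conv_lhs => rw [e2]
    rw [← Real.exp_add, ← Real.exp_add]
    congr 1
    ring
  simp only [e3, e4]
  rw [e5]
  exact key

/-- The Hedberg-type majorant of the multilinear potential. -/
noncomputable def hedbergMajorant {n m : ℕ} (p δ : ℝ)
    (h : (Fin m → EuclideanSpace ℝ (Fin n)) → ℝ) (x : EuclideanSpace ℝ (Fin n)) : ENNReal :=
  ∑ k, ∫⁻ y : Fin m → EuclideanSpace ℝ (Fin n),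
    ENNReal.ofReal (h y ^ p) * ENNReal.ofReal (logKernel δ (p * Real.log (h y) / m) (x - y k))

/-- With `y` fixed, the `x`-integral is that of a translated `logKernel`, whatever the value of `h
y` in its parameter. -/
theorem lintegral_hedbergMajorant {n m : ℕ} (hn : 1 ≤ n) {p δ : ℝ} (hδ : 0 < δ)
    {h : (Fin m → EuclideanSpace ℝ (Fin n)) → ℝ} (hh : Measurable h) :
    ∫⁻ x, hedbergMajorant p δ h x = m * ((∫⁻ y, ENNReal.ofReal (h y ^ p)) *
      ENNReal.ofReal (∫ w : EuclideanSpace ℝ (Fin n), logKernel δ 0 w)) := by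
  have hmeas : ∀ k, Measurable fun z : EuclideanSpace ℝ (Fin n) ×
      (Fin m → EuclideanSpace ℝ (Fin n)) => ENNReal.ofReal (h z.2 ^ p) *
        ENNReal.ofReal (logKernel δ (p * Real.log (h z.2) / m) (z.1 - z.2 k)) := fun k => by
    have := (measurable_logKernel (n := n) δ).comp
      (f := fun z : EuclideanSpace ℝ (Fin n) × (Fin m → EuclideanSpace ℝ (Fin n)) =>
        (p * Real.log (h z.2) / m, z.1 - z.2 k)) (by fun_prop)
    simp only [Function.comp_def] at this
    fun_prop
  unfold hedbergMajorant
  rw [lintegral_finsetSum _ fun k _ => (hmeas k).lintegral_prod_right']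
  have : ∀ k : Fin m, ∫⁻ x : EuclideanSpace ℝ (Fin n),
      ∫⁻ y : Fin m → EuclideanSpace ℝ (Fin n), ENNReal.ofReal (h y ^ p) *
        ENNReal.ofReal (logKernel δ (p * Real.log (h y) / m) (x - y k)) =
      (∫⁻ y, ENNReal.ofReal (h y ^ p)) *
        ENNReal.ofReal (∫ w : EuclideanSpace ℝ (Fin n), logKernel δ 0 w) := fun k => by
    rw [lintegral_lintegral_swap (hmeas k).aemeasurable, ← lintegral_mul_const _ (by fun_prop)]
    refine lintegral_congr fun y => ?_
    rw [lintegral_const_mul' _ _ ENNReal.ofReal_ne_top, lintegral_sub_right_eq_self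
      (fun w => ENNReal.ofReal (logKernel δ (p * Real.log (h y) / m) w)), lintegral_logKernel hn hδ]
  simp [this]

theorem lintegral_rieszKernel_mul_le {n m : ℕ} (hn : 1 ≤ n) (hm : 0 < m) {p q ε : ℝ}
    {s : Fin m → ℝ} (hp : 1 < p) (hq : 0 < q) (hs : ∀ k, 0 < s k) (hε : 0 < ε)
    (h₀ : ε ≤ 1 / p - 1 / q) (h₁ : ε ≤ 1 - 1 / p) (hθ : ∀ k, ε ≤ 1 / s k - (1 - 1 / p))
    (hscale : 1 / q + m * (1 - 1 / p) = ∑ k, 1 / s k)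
    {h : (Fin m → EuclideanSpace ℝ (Fin n)) → ℝ} (hh : Measurable h) (h_nonneg : ∀ y, 0 ≤ h y)
    (h_le : ∫⁻ y, ENNReal.ofReal (h y ^ p) ≤ 1) (x : EuclideanSpace ℝ (Fin n)) :
    ∫⁻ y, ENNReal.ofReal (rieszKernel (fun k => n / s k) x y * h y) ≤
      (1 + ENNReal.ofReal
        ((∫ w : EuclideanSpace ℝ (Fin n), logKernel (ε / (m + 1)) 0 w) ^ m) + 1) *
      hedbergMajorant p (ε / (m + 1)) h x ^ (1 / q) := by
  have hδ : 0 < ε / (m + 1) := by positivity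
  refine ENNReal.le_of_forall_exp_mul_le hq (by simp) fun X => ?_
  rw [← lintegral_const_mul' _ _ ENNReal.ofReal_ne_top]
  have hm1 : ∀ k, Measurable fun y : Fin m → EuclideanSpace ℝ (Fin n) =>
      ENNReal.ofReal (h y ^ p) *
        ENNReal.ofReal (logKernel (ε / (m + 1)) (p * Real.log (h y) / m) (x - y k)) := fun k => by
    have := (measurable_logKernel (n := n) (ε / (m + 1))).comp
      (f := fun y : Fin m → EuclideanSpace ℝ (Fin n) =>
        (p * Real.log (h y) / m, x - y k)) (by fun_prop)
    simp only [Function.comp_def] at this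
    fun_prop
  calc
    _ ≤ ∫⁻ y : Fin m → EuclideanSpace ℝ (Fin n),
        (ENNReal.ofReal (Real.exp X) * ENNReal.ofReal (h y ^ p) +
          ENNReal.ofReal (Real.exp X) *
            ENNReal.ofReal (∏ k, logKernel (ε / (m + 1)) X (x - y k))) +
        ∑ k, ENNReal.ofReal (h y ^ p) *
          ENNReal.ofReal (logKernel (ε / (m + 1)) (p * Real.log (h y) / m) (x - y k)) := by
      refine lintegral_mono fun y => ?_
      have hy := Real.rpow_nonneg (h_nonneg y) p
      have hsum : ∑ k, ENNReal.ofReal (h y ^ p) *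
          ENNReal.ofReal (logKernel (ε / (m + 1)) (p * Real.log (h y) / m) (x - y k)) =
          ENNReal.ofReal (∑ k, h y ^ p *
            logKernel (ε / (m + 1)) (p * Real.log (h y) / m) (x - y k)) := by
        rw [ENNReal.ofReal_sum_of_nonneg fun k _ => mul_nonneg hy (logKernel_pos _ _ _).le]
        exact Finset.sum_congr rfl fun k _ => (ENNReal.ofReal_mul hy).symm
      have hprod := Finset.prod_nonneg fun (k : Fin m) (_ : k ∈ Finset.univ) =>
        (logKernel_pos (ε / (m + 1)) X (x - y k)).le
      have hX := (Real.exp_pos X).le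
      rw [hsum, ← ENNReal.ofReal_mul (Real.exp_pos _).le, ← ENNReal.ofReal_mul hX,
        ← ENNReal.ofReal_mul hX, ← ENNReal.ofReal_add (mul_nonneg hX hy) (mul_nonneg hX hprod),
        ← ENNReal.ofReal_add (add_nonneg (mul_nonneg hX hy) (mul_nonneg hX hprod))
          (Finset.sum_nonneg fun k _ => mul_nonneg hy (logKernel_pos _ _ _).le)]
      exact ENNReal.ofReal_le_ofReal
        (exp_mul_rieszKernel_mul_le hn hm hp hs hε.le h₀ h₁ hθ hscale x y (h_nonneg y) X)
    _ = ENNReal.ofReal (Real.exp X) * ((∫⁻ y, ENNReal.ofReal (h y ^ p)) + ENNReal.ofReal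
          ((∫ w : EuclideanSpace ℝ (Fin n), logKernel (ε / (m + 1)) 0 w) ^ m)) +
        hedbergMajorant p (ε / (m + 1)) h x := by
      rw [lintegral_add_right _ (Finset.measurable_sum _ fun k _ => hm1 k),
        lintegral_add_left (by fun_prop), lintegral_const_mul' _ _ ENNReal.ofReal_ne_top,
        lintegral_const_mul' _ _ ENNReal.ofReal_ne_top, lintegral_prod_logKernel hn hδ,
        lintegral_finsetSum _ fun k _ => hm1 k, mul_add, hedbergMajorant]
    _ ≤ _ := by gcongr

theorem exists_pos_le_forall_fin {m : ℕ} {a b : ℝ} {c : Fin m → ℝ} (ha : 0 < a) (hb : 0 < b)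
    (hc : ∀ k, 0 < c k) : ∃ ε, 0 < ε ∧ ε ≤ a ∧ ε ≤ b ∧ ∀ k, ε ≤ c k := by
  let L : Option (Option (Fin m)) → ℝ := fun v => v.elim a fun w => w.elim b c
  obtain ⟨v, hv⟩ := Finite.exists_min L
  refine ⟨L v, ?_, hv none, hv (some none), fun k => hv (some (some k))⟩
  rcases v with _ | _ | k
  exacts [ha, hb, hc k]

/-! ### From the pointwise bound to the norm inequality -/

theorem exists_lintegral_rpow_le {n m : ℕ} (hn : 1 ≤ n) (hm : 0 < m) {p q : ℝ}
    {s : Fin m → ℝ} (hp : 1 < p) (hpq : p < q) (hs : ∀ k, 0 < s k)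
    (hs' : ∀ k, 1 - 1 / p < 1 / s k) (hscale : 1 / q + m * (1 - 1 / p) = ∑ k, 1 / s k) :
    ∃ C : ENNReal, C ≠ ⊤ ∧ ∀ h : (Fin m → EuclideanSpace ℝ (Fin n)) → ℝ, Measurable h →
      (∀ y, 0 ≤ h y) → ∫⁻ y, ENNReal.ofReal (h y ^ p) ≤ 1 →
      ∫⁻ x, (∫⁻ y, ENNReal.ofReal (rieszKernel (fun k => n / s k) x y * h y)) ^ q ≤ C := by
  have hp0 : 0 < p := by linarith
  have hq : 0 < q := by linarith
  obtain ⟨ε, hε, h₀, h₁, hθ⟩ := exists_pos_le_forall_fin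
    (sub_pos.2 (one_div_lt_one_div_of_lt hp0 hpq))
    (sub_pos.2 ((div_lt_one hp0).2 hp)) (fun k => sub_pos.2 (hs' k))
  have hδ : 0 < ε / (m + 1) := by positivity
  refine ⟨(1 + ENNReal.ofReal
    ((∫ w : EuclideanSpace ℝ (Fin n), logKernel (ε / (m + 1)) 0 w) ^ m) + 1) ^ q *
    (m * (1 * ENNReal.ofReal (∫ w : EuclideanSpace ℝ (Fin n), logKernel (ε / (m + 1)) 0 w))),
    ?_, fun h hh h_nonneg h_le => ?_⟩
  · refine ENNReal.mul_ne_top (ENNReal.rpow_ne_top_of_nonneg hq.le (by simp)) ?_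
    exact ENNReal.mul_ne_top (by simp) (by simp)
  · calc
      _ ≤ ∫⁻ x, (1 + ENNReal.ofReal
            ((∫ w : EuclideanSpace ℝ (Fin n), logKernel (ε / (m + 1)) 0 w) ^ m) + 1) ^ q *
          hedbergMajorant p (ε / (m + 1)) h x := by
        refine lintegral_mono fun x => ?_
        refine (ENNReal.rpow_le_rpow (lintegral_rieszKernel_mul_le hn hm hp hq hs hε h₀ h₁ hθ
          hscale hh h_nonneg h_le x) hq.le).trans_eq ?_
        rw [ENNReal.mul_rpow_of_nonneg _ _ hq.le, ← ENNReal.rpow_mul, one_div,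
          inv_mul_cancel₀ hq.ne', ENNReal.rpow_one]
      _ ≤ _ := by
        rw [lintegral_const_mul' _ _ (ENNReal.rpow_ne_top_of_nonneg hq.le (by simp)),
          lintegral_hedbergMajorant hn hδ hh]
        gcongr

/-- The absolute version of the inequality, for a measurable function. -/
theorem exists_lintegral_rieszKernel_le_eLpNorm {n m : ℕ} (hn : 1 ≤ n) (hm : 0 < m) {p q : ℝ}
    {s : Fin m → ℝ} (hp : 1 < p) (hpq : p < q) (hs : ∀ k, 0 < s k)
    (hs' : ∀ k, 1 - 1 / p < 1 / s k) (hscale : 1 / q + m * (1 - 1 / p) = ∑ k, 1 / s k) :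
    ∃ C : ℝ, 0 < C ∧ ∀ H : (Fin m → EuclideanSpace ℝ (Fin n)) → ℂ, Measurable H →
      MemLp H (ENNReal.ofReal p) volume →
      (∫⁻ x, (∫⁻ y, ‖(rieszKernel (fun k => n / s k) x y : ℂ) * H y‖ₑ) ^ q) ^ (1 / q) ≤
        ENNReal.ofReal C * eLpNorm H (ENNReal.ofReal p) volume := by
  have hp0 : 0 < p := by linarith
  have hq : 0 < q := by linarith
  obtain ⟨C, hC, hCle⟩ := exists_lintegral_rpow_le hn hm hp hpq hs hs' hscale
  refine ⟨(C ^ (1 / q)).toReal + 1, by positivity, fun H hH hLp => ?_⟩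
  have hp_ne : ENNReal.ofReal p ≠ 0 := by simpa using hp0
  rcases eq_or_ne (eLpNorm H (ENNReal.ofReal p) volume) 0 with h0 | h0
  · have hH0 := (eLpNorm_eq_zero_iff hLp.1 hp_ne).1 h0
    have : ∀ x, ∫⁻ y, ‖(rieszKernel (fun k => n / s k) x y : ℂ) * H y‖ₑ = 0 := fun x => by
      rw [← lintegral_zero (μ := (volume : Measure (Fin m → EuclideanSpace ℝ (Fin n))))]
      refine lintegral_congr_ae ?_
      filter_upwards [hH0] with y hy
      simp [hy]
    simp only [this]
    simp [hq]
  · set N := (eLpNorm H (ENNReal.ofReal p) volume).toReal with hN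
    have hNpos : 0 < N := ENNReal.toReal_pos h0 hLp.2.ne
    have hNe : eLpNorm H (ENNReal.ofReal p) volume = ENNReal.ofReal N :=
      (ENNReal.ofReal_toReal hLp.2.ne).symm
    have hint : ∫⁻ y, ‖H y‖ₑ ^ p = ENNReal.ofReal N ^ p := by
      rw [← hNe, eLpNorm_eq_lintegral_rpow_enorm_toReal hp_ne ENNReal.ofReal_ne_top,
        ENNReal.toReal_ofReal hp0.le, ← ENNReal.rpow_mul, one_div, inv_mul_cancel₀ hp0.ne',
        ENNReal.rpow_one]
    have hNp : ENNReal.ofReal N ^ p ≠ 0 := by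
      rw [ENNReal.ofReal_rpow_of_pos hNpos]
      simpa using Real.rpow_pos_of_pos hNpos p
    have hNp' : ENNReal.ofReal N ^ p ≠ ⊤ := ENNReal.rpow_ne_top_of_nonneg hp0.le (by simp)
    -- By homogeneity it suffices to treat the normalised modulus.
    have hbound := hCle (fun y => N⁻¹ * ‖H y‖) (by fun_prop) (fun y => by positivity) (by
      have : ∀ y, ENNReal.ofReal ((N⁻¹ * ‖H y‖) ^ p) =
          (ENNReal.ofReal N ^ p)⁻¹ * ‖H y‖ₑ ^ p := fun y => by
        rw [← ENNReal.ofReal_rpow_of_nonneg (by positivity) hp0.le,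
          ENNReal.ofReal_mul (by positivity), ENNReal.mul_rpow_of_nonneg _ _ hp0.le,
          ENNReal.ofReal_inv_of_pos hNpos, ENNReal.inv_rpow, ofReal_norm]
      simp only [this]
      rw [lintegral_const_mul _ (by fun_prop), hint, ENNReal.inv_mul_cancel hNp hNp'])
    have hscal : ∀ x, ∫⁻ y, ‖(rieszKernel (fun k => n / s k) x y : ℂ) * H y‖ₑ =
        ENNReal.ofReal N * ∫⁻ y, ENNReal.ofReal
          (rieszKernel (fun k => n / s k) x y * (N⁻¹ * ‖H y‖)) := fun x => by
      rw [← lintegral_const_mul' _ _ ENNReal.ofReal_ne_top]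
      refine lintegral_congr fun y => ?_
      rw [← ENNReal.ofReal_mul hNpos.le, ← ofReal_norm, norm_mul, Complex.norm_real,
        Real.norm_of_nonneg (rieszKernel_nonneg _ _ _)]
      congr 1
      field_simp
    simp only [hscal, ENNReal.mul_rpow_of_nonneg _ _ hq.le]
    rw [lintegral_const_mul' _ _ (ENNReal.rpow_ne_top_of_nonneg hq.le (by simp)),
      ENNReal.mul_rpow_of_nonneg _ _ (by positivity), ← ENNReal.rpow_mul, mul_one_div_cancel hq.ne',
      ENNReal.rpow_one, hNe, mul_comm]
    gcongr
    calc _ ≤ C ^ (1 / q) := ENNReal.rpow_le_rpow hbound (by positivity)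
      _ = ENNReal.ofReal (C ^ (1 / q)).toReal :=
        (ENNReal.ofReal_toReal (ENNReal.rpow_ne_top_of_nonneg (by positivity) hC)).symm
      _ ≤ _ := ENNReal.ofReal_le_ofReal (by linarith)

theorem multilinearRiesz_congr_ae {n m : ℕ} (lam : Fin m → ℝ)
    {H H' : (Fin m → EuclideanSpace ℝ (Fin n)) → ℂ} (h : H =ᵐ[volume] H') :
    multilinearRiesz lam H = multilinearRiesz lam H' := by
  funext x
  refine integral_congr_ae ?_
  filter_upwards [h] with y hy
  simp only [hy]

theorem mainTheorem4 (n m : ℕ) (hn : 1 ≤ n) (p q : ℝ) (s : Fin m → ℝ)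
    (hp : 1 < p) (hpq : p < q)
    (hs : ∀ k, 1 < s k ∧ s k < p.conjExponent)
    (hscale : 1 / q + m / p.conjExponent = ∑ k, 1 / s k) :
    ∃ C : ℝ, 0 < C ∧
      ∀ H : (Fin m → EuclideanSpace ℝ (Fin n)) → ℂ,
        MemLp H (ENNReal.ofReal p) volume →
          (∀ᵐ x : EuclideanSpace ℝ (Fin n),
            Integrable (fun y : Fin m → EuclideanSpace ℝ (Fin n) =>
              (rieszKernel (fun k => n / s k) x y : ℂ) * H y) volume) ∧
          MemLp (multilinearRiesz (fun k => n / s k) H) (ENNReal.ofReal q) volume ∧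
          eLpNorm (multilinearRiesz (fun k => n / s k) H) (ENNReal.ofReal q) volume
            ≤ ENNReal.ofReal C * eLpNorm H (ENNReal.ofReal p) volume := by
  have hp0 : 0 < p := by linarith
  have hq : 0 < q := by linarith
  have hconj : 1 / p.conjExponent = 1 - 1 / p := by
    rw [Real.conjExponent]
    field_simp
  -- For `m = 0` the scaling condition would read `1 / q = 0`.
  have hm : 0 < m := by
    rcases Nat.eq_zero_or_pos m with rfl | hm
    · have : 0 < 1 / q := by positivity
      simp at hscale
      exact absurd hscale hq.ne'
    · exact hm
  rw [div_eq_mul_one_div (m : ℝ), hconj] at hscale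
  obtain ⟨C, hC, hCle⟩ := exists_lintegral_rieszKernel_le_eLpNorm hn hm hp hpq
    (fun k => one_pos.trans (hs k).1)
    (fun k => hconj ▸ one_div_lt_one_div_of_lt (one_pos.trans (hs k).1) (hs k).2) hscale
  refine ⟨C, hC, fun H hH => ?_⟩
  obtain ⟨H', hH'm, hHH'⟩ := hH.1
  have hH' : MemLp H' (ENNReal.ofReal p) volume := hH.ae_eq hHH'
  rw [multilinearRiesz_congr_ae _ hHH', eLpNorm_congr_ae hHH']
  have hbound := hCle H' hH'm.measurable hH'
  have hfin : ENNReal.ofReal C * eLpNorm H' (ENNReal.ofReal p) volume < ⊤ :=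
    ENNReal.mul_lt_top ENNReal.ofReal_lt_top hH'.2
  have hmeas : Measurable fun z : EuclideanSpace ℝ (Fin n) × (Fin m → EuclideanSpace ℝ (Fin n)) =>
      (rieszKernel (fun k => n / s k) z.1 z.2 : ℂ) * H' z.2 :=
    (Complex.measurable_ofReal.comp (measurable_rieszKernel _)).mul
      (hH'm.measurable.comp measurable_snd)
  have hle : eLpNorm (multilinearRiesz (fun k => n / s k) H') (ENNReal.ofReal q) volume
      ≤ ENNReal.ofReal C * eLpNorm H' (ENNReal.ofReal p) volume := by
    refine le_trans ?_ hbound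
    rw [eLpNorm_eq_lintegral_rpow_enorm_toReal (by simpa using hq) ENNReal.ofReal_ne_top,
      ENNReal.toReal_ofReal hq.le]
    gcongr
    exact enorm_integral_le_lintegral_enorm _
  refine ⟨?_, ⟨hmeas.stronglyMeasurable.integral_prod_right'.aestronglyMeasurable,
    hle.trans_lt hfin⟩, hle⟩
  -- The bound controls the integral of absolute values, so its finiteness also yields absolute
  -- convergence for almost every `x`.
  have hlt : ∫⁻ x, (∫⁻ y, ‖(rieszKernel (fun k => n / s k) x y : ℂ) * H' y‖ₑ) ^ q ≠ ⊤ := by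
    intro htop
    rw [htop, ENNReal.top_rpow_of_pos (by positivity)] at hbound
    exact absurd hbound (not_le.2 hfin)
  filter_upwards [ae_lt_top (hmeas.enorm.lintegral_prod_right'.pow_const q) hlt] with x hx
  have hint : Integrable (fun y : Fin m → EuclideanSpace ℝ (Fin n) =>
      (rieszKernel (fun k => n / s k) x y : ℂ) * H' y) volume :=
    ⟨(hmeas.comp measurable_prodMk_left).aestronglyMeasurable,
      (ENNReal.rpow_lt_top_iff_of_pos hq).1 hx⟩
  refine hint.congr ?_
  filter_upwards [hHH'] with y hy
  rw [hy]
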